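/- Let $\mathbb{K}$ be a number field embedded in $\mathbb{C}$, with ring of integers $\mathcal{O}_{\mathbb{K}}$; put $\mathbb{L}=\mathbb{R}$ if $\mathbb{K}\subset\mathbb{R}$ and $\mathbb{L}=\mathbb{C}$ otherwise. Let $o(1)$ denote any sequence that tends to $0$ as $n\to\infty$ (possibly a different one at each occurrence); relations involving $o(1)$ are required for all sufficiently large $n$. Let $(Q_n)_{n\ge 0}$ be a non-decreasing sequence of positive real numbers with limit $+\infty$ such that $Q_{n+1}=Q_n^{1+o(1)}$, the $o(1)$ being real. Let $T\ge 1$ be an integer, let $c_1,\dots,c_T$ be non-zero complex numbers, and let $\zeta_1,\dots,\zeta_T$ be pairwise distinct complex numbers with $|\zeta_t|=1$ for all $t$. Let $\vartheta_1,\dots,\vartheta_N\in\mathbb{L}$ and let $\tau>0$ be a real number. Assume that there exist $N$ sequences $(p_{j,n})_{n\ge 0}$, $1\le j\le N$, of elements of $\mathcal{O}_{\mathbb{K}}$ such that, for each $j$, all Galois conjugates of $p_{j,n}$ (that is, all $\sigma(p_{j,n})$ with $\sigma$ an embedding of $\mathbb{K}$ into $\mathbb{C}$) have modulus less than $Q_n^{1+o(1)}$,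 the $o(1)$ being real and independent of the conjugate, and such that $$\sum_{j=1}^N p_{j,n}\vartheta_j = Q_n^{-\tau+o(1)}\Big(\sum_{t=1}^T c_t\zeta_t^n+o(1)\Big),$$ where both $o(1)$ may be complex-valued and $Q_n^{z}=\exp(z\log Q_n)$. Then $$\dim_{\mathbb{K}}\mathrm{Span}_{\mathbb{K}}(\vartheta_1,\dots,\vartheta_N)\ \ge\ \frac{\tau+1}{[\mathbb{K}:\mathbb{Q}]}.$$ -/

import Mathlib

open Filter Topology NumberField

/-- For a field `K` embedded in `ℂ` (through `algebraMap K ℂ`): the subfield `ℝ` of `ℂ` if the image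
of `K` is contained in `ℝ`, and the whole field `ℂ` otherwise. -/
noncomputable def realOrComplexField (K : Type*) [Field K] [Algebra K ℂ] : Subfield ℂ :=
  open Classical in
  if (algebraMap K ℂ).fieldRange ≤ Complex.ofRealHom.fieldRange then
    Complex.ofRealHom.fieldRange
  else ⊤

/-! This is a Nesterenko-type criterion, reduced to integer forms. By Vandermonde, a power sum with
distinct unimodular roots cannot be small at `T` consecutive indices; as `Q` grows slowly, every
large scale `Y` has a form of size `Y ^ (-τ + o(1))` whose coefficients have conjugates at most `Y ^
(1 + o(1))` (`exists_small_forms_of_oscillating`). Writing the numbers in `d` vectors `f k`, `d` the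
dimension of the span, and the coefficients in an integral basis `ω i`, real parts give integer
forms in the `d * [K : ℚ]` reals `Re (ω i * f k)`.

It remains to see that `m` reals with such forms satisfy `m ≥ τ + 1`
(`add_one_le_card_of_small_forms`). If `m - 1 < τ`, Dirichlet gives `q` and integers `x i` close to
`q * ξ i`. Take a form `ℓ` at a scale `Y` of order about `q ^ (1 / τ)`, so that `q * |ℓ| ≤ 1 / 4`.
Replacing `q * ξ i` by `x i` moves `q * ℓ` by less than `q * |ℓ|`, leaving a non-zero integer of
modulus below `1`. -/

/-! ### Diophantine approximation over the integers. -/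

/-- Dirichlet's theorem on simultaneous approximation, with one coordinate normalized to `1`. -/
theorem exists_simultaneous_approximation {ι : Type*} [Fintype ι] (α : ι → ℝ) (i₀ : ι)
    (hα : α i₀ = 1) (N : ℕ) (hN : 0 < N) :
    ∃ q : ℕ, 1 ≤ q ∧ q ≤ N ^ (Fintype.card ι - 1) ∧
      ∃ x : ι → ℤ, ∀ i, |(x i : ℝ) - q * α i| ≤ 1 / N := by
  classical
  have hN' : (0 : ℝ) < N := by exact_mod_cast hN
  set s := Fintype.card ι - 1 with hs
  have hcard : Fintype.card {i // i ≠ i₀} = s := by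
    rw [Fintype.card_subtype_compl, Fintype.card_subtype_eq]
  have hlt (y : ℝ) : ⌊Int.fract y * N⌋₊ < N := by
    rw [Nat.floor_lt (by positivity)]
    have := Int.fract_lt_one y
    nlinarith
  -- Pigeonhole on boxes of side `1 / N`; the coordinate `i₀` needs no box, since `q * 1` is an
  -- integer.
  let f : Fin (N ^ s + 1) → ({i // i ≠ i₀} → Fin N) :=
    fun j i => ⟨⌊Int.fract ((j : ℕ) * α i) * N⌋₊, hlt _⟩
  obtain ⟨j, k, hjk, hf⟩ := Fintype.exists_ne_map_eq_of_card_lt f (by simp [← hcard])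
  wlog hlt' : j < k generalizing j k
  · exact this k j hjk.symm hf.symm (lt_of_le_of_ne (not_lt.1 hlt') hjk.symm)
  have hlt'' : (j : ℕ) < k := hlt'
  refine ⟨k - j, by omega, by omega, fun i => if i = i₀ then ((k : ℕ) : ℤ) - (j : ℕ)
    else ⌊(k : ℕ) * α i⌋ - ⌊(j : ℕ) * α i⌋, fun i => ?_⟩
  rw [Nat.cast_sub hlt''.le]
  by_cases hi : i = i₀
  · subst hi
    simp [hα]
  · have h := congrArg Fin.val (congrFun hf ⟨i, hi⟩)
    simp only [f] at h
    have e : ∀ y : ℝ, (⌊Int.fract y * N⌋₊ : ℝ) ≤ Int.fract y * N ∧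
        Int.fract y * N < ⌊Int.fract y * N⌋₊ + 1 :=
      fun y => ⟨Nat.floor_le (by positivity), Nat.lt_floor_add_one _⟩
    have e1 := e ((j : ℕ) * α i)
    have e2 := e ((k : ℕ) * α i)
    rw [h] at e1
    rw [abs_le, ← neg_div, div_le_iff₀ hN', le_div_iff₀ hN']
    simp only [hi, if_false, Int.fract] at *
    push_cast
    constructor <;> nlinarith

/-- Small linear forms with integer coefficients at every scale force many coordinates. -/
theorem add_one_le_card_of_small_forms {ι : Type*} [Fintype ι] (ξ : ι → ℝ) (τ : ℝ) (hτ : 0 < τ)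
    (C : ℝ) (hC : 0 < C)
    (h : ∀ ε > 0, ∃ Y₀ : ℝ, ∀ Y ≥ Y₀, ∃ a : ι → ℤ, (∀ i, |(a i : ℝ)| ≤ C * Y ^ (1 + ε)) ∧
      C⁻¹ * Y ^ (-τ - ε) ≤ |∑ i, a i * ξ i| ∧ |∑ i, a i * ξ i| ≤ C * Y ^ (-τ + ε)) :
    τ + 1 ≤ Fintype.card ι := by
  classical
  by_contra! hcon
  obtain ⟨i₀, hi₀⟩ : ∃ i₀, ξ i₀ ≠ 0 := by
    by_contra! h0
    obtain ⟨Y₀, hY⟩ := h 1 one_pos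
    obtain ⟨a, -, h2, -⟩ := hY (max Y₀ 1) (le_max_left _ _)
    simp only [h0, mul_zero, Finset.sum_const_zero, abs_zero] at h2
    have : (0 : ℝ) < max Y₀ 1 := by positivity
    exact absurd h2 (not_le.2 (by positivity))
  wlog h1 : ξ i₀ = 1 generalizing ξ C
  · have hpos : 0 < |ξ i₀| := abs_pos.2 hi₀
    set κ := |ξ i₀|
    refine this (fun i => ξ i / ξ i₀) (C * max κ (max κ⁻¹ 1)) (by positivity) ?_
      (by simp [hi₀]) (by simp [hi₀])
    intro ε hε
    obtain ⟨Y₀, hY⟩ := h ε hε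
    refine ⟨max Y₀ 1, fun Y hYY => ?_⟩
    obtain ⟨a, ha1, ha2, ha3⟩ := hY Y (le_trans (le_max_left _ _) hYY)
    have hY1 : 1 ≤ Y := le_trans (le_max_right _ _) hYY
    have hY0 : 0 < Y := by linarith
    have hsum : |∑ i, a i * (ξ i / ξ i₀)| = |∑ i, a i * ξ i| * κ⁻¹ := by
      rw [← abs_inv, ← abs_mul, Finset.sum_mul]
      simp [div_eq_mul_inv, mul_assoc]
    refine ⟨a, fun i => (ha1 i).trans ?_, ?_, ?_⟩
    · have : 1 ≤ max κ (max κ⁻¹ 1) := (le_max_right _ _).trans (le_max_right _ _)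
      gcongr
      nlinarith
    · rw [hsum, mul_inv]
      have : (max κ (max κ⁻¹ 1))⁻¹ ≤ κ⁻¹ := inv_anti₀ hpos (le_max_left _ _)
      calc _ = C⁻¹ * Y ^ (-τ - ε) * (max κ (max κ⁻¹ 1))⁻¹ := by ring
        _ ≤ _ := by gcongr
    · rw [hsum]
      have : κ⁻¹ ≤ max κ (max κ⁻¹ 1) := (le_max_left _ _).trans (le_max_right _ _)
      calc _ ≤ C * Y ^ (-τ + ε) * max κ (max κ⁻¹ 1) := by gcongr
        _ = _ := by ring
  have hm : 0 < Fintype.card ι := Fintype.card_pos_iff.2 ⟨i₀⟩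
  set s := Fintype.card ι - 1 with hs
  have hsm : Fintype.card ι = s + 1 := by omega
  have hsτ : (s : ℝ) < τ := by rw [hsm] at hcon; push_cast at hcon; linarith
  -- The last inequality says `ε * (3 * s + 1) < τ - s`; hence the denominator `3 * s + 2`.
  obtain ⟨ε, hε, hετ, hεs⟩ : ∃ ε > 0, ε < τ ∧ s * (1 + 3 * ε) < τ - ε := by
    have hs0 : (0 : ℝ) ≤ s := by positivity
    have hd : 0 < 3 * (s : ℝ) + 2 := by positivity
    refine ⟨(τ - s) / (3 * s + 2), by have := sub_pos.2 hsτ; positivity, ?_, ?_⟩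
    · rw [div_lt_iff₀ hd]; nlinarith
    · have : (τ - s) / (3 * s + 2) * (3 * s + 2) = τ - s := div_mul_cancel₀ _ hd.ne'
      have : 0 < (τ - s) / (3 * s + 2) := by have := sub_pos.2 hsτ; positivity
      nlinarith
  obtain ⟨Y₀, hY⟩ := h ε hε
  set u := τ - ε with hu
  have hu0 : 0 < u := sub_pos.2 hετ
  set v := 1 + τ + 2 * ε with hv
  have hv0 : 0 < v := by positivity
  set Z := max Y₀ 1
  have hZ1 : 1 ≤ Z := le_max_right _ _
  set D := max (4 * C) 1
  have hD1 : 1 ≤ D := le_max_right _ _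
  set A := Z ^ v * D ^ (u⁻¹ * v)
  have hγ : 0 < 1 - s * ((1 + 3 * ε) / u) := by
    rw [← mul_div_assoc, sub_pos, div_lt_one hu0]; exact hεs
  -- `A` does not involve `q`, so `N` can be fixed before Dirichlet produces `q`.
  obtain ⟨N, hN, hN0⟩ := ((tendsto_rpow_atTop hγ).comp tendsto_natCast_atTop_atTop
    |>.eventually_gt_atTop (Fintype.card ι * C ^ 2 * A) |>.and (eventually_gt_atTop 0)).exists
  simp only [Function.comp_apply] at hN
  have hN0' : (0 : ℝ) < N := by exact_mod_cast hN0
  obtain ⟨q, hq1, hqN, x, hx⟩ := exists_simultaneous_approximation ξ i₀ h1 N hN0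
  have hq1' : (1 : ℝ) ≤ q := by exact_mod_cast hq1
  have hq0 : (0 : ℝ) < q := by linarith
  -- The scale follows the actual `q`, not its bound `N ^ s`: `Y ^ u ≥ 4 * C * q` makes `q * |ℓ|`
  -- small.
  set W := (D * q) ^ u⁻¹ with hW
  have hDq : 1 ≤ D * q := by nlinarith
  have hW1 : 1 ≤ W := Real.one_le_rpow hDq (by positivity)
  set Y := Z * W with hYdef
  have hY1 : 1 ≤ Y := by nlinarith
  have hY0 : 0 < Y := by linarith
  obtain ⟨a, ha1, ha2, ha3⟩ := hY Y ((le_max_left _ _).trans (by nlinarith : Z ≤ Z * W))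
  set ℓ := ∑ i, a i * ξ i
  have hup : q * |ℓ| ≤ 1 / 4 := by
    have h4 : 4 * C * q ≤ Y ^ u := by
      calc 4 * C * q ≤ D * q := by gcongr; exact le_max_left _ _
        _ = W ^ u := by rw [hW, ← Real.rpow_mul (by positivity), inv_mul_cancel₀ hu0.ne',
              Real.rpow_one]
        _ ≤ Y ^ u := by gcongr; nlinarith
    have : Y ^ (-τ + ε) = (Y ^ u)⁻¹ := by
      rw [← Real.rpow_neg hY0.le]; congr 1; rw [hu]; ring
    rw [this] at ha3
    have hp : 0 < Y ^ u := by positivity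
    calc q * |ℓ| ≤ q * (C * (Y ^ u)⁻¹) := by gcongr
      _ = (4 * C * q) * (Y ^ u)⁻¹ / 4 := by ring
      _ ≤ Y ^ u * (Y ^ u)⁻¹ / 4 := by gcongr
      _ = 1 / 4 := by rw [mul_inv_cancel₀ hp.ne']
  -- Since `v = u + (1 + 3 * ε)`, one factor `q` splits off; only the rest is bounded by `q ≤ N ^
  -- s`.
  have hYv : Y ^ v ≤ A * (q * N ^ (s * ((1 + 3 * ε) / u))) := by
    have e1 : (q : ℝ) ^ (u⁻¹ * v) = q * (q : ℝ) ^ ((1 + 3 * ε) / u) := by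
      nth_rewrite 2 [← Real.rpow_one (q : ℝ)]
      rw [← Real.rpow_add hq0]
      congr 1
      field_simp
      rw [hu, hv]; ring
    have e2 : (q : ℝ) ^ ((1 + 3 * ε) / u) ≤ N ^ (s * ((1 + 3 * ε) / u)) := by
      rw [Real.rpow_mul hN0'.le, Real.rpow_natCast]
      gcongr
      exact_mod_cast hqN
    rw [hYdef, hW, Real.mul_rpow (by positivity) (by positivity), ← Real.rpow_mul (by positivity),
      Real.mul_rpow (by positivity) hq0.le, e1, ← mul_assoc]
    gcongr
  have herr : |∑ i, a i * (x i - q * ξ i)| < q * |ℓ| := by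
    calc |∑ i, a i * (x i - q * ξ i)| ≤ ∑ i, |a i * (x i - q * ξ i)| :=
          Finset.abs_sum_le_sum_abs _ _
      _ ≤ ∑ _i : ι, C * Y ^ (1 + ε) * (1 / N) := by
          gcongr with i
          rw [abs_mul]
          gcongr
          exacts [ha1 i, hx i]
      _ = Fintype.card ι * C * Y ^ (1 + ε) / N := by
          rw [Finset.sum_const, Finset.card_univ, nsmul_eq_mul]; ring
      _ < q * (C⁻¹ * Y ^ (-τ - ε)) := by
          rw [div_lt_iff₀ hN0']
          have e3 : Y ^ v * Y ^ (-τ - ε) = Y ^ (1 + ε) := by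
            rw [← Real.rpow_add hY0]; congr 1; rw [hv]; ring
          have e4 : (N : ℝ) ^ (1 - s * ((1 + 3 * ε) / u)) * N ^ (s * ((1 + 3 * ε) / u)) = N := by
            rw [← Real.rpow_add hN0', sub_add_cancel, Real.rpow_one]
          rw [← e3]
          have hP : 0 < Y ^ (-τ - ε) := by positivity
          have hX : 0 < (N : ℝ) ^ (s * ((1 + 3 * ε) / u)) := by positivity
          calc Fintype.card ι * C * (Y ^ v * Y ^ (-τ - ε))
              ≤ Fintype.card ι * C * (A * (q * N ^ (s * ((1 + 3 * ε) / u))) * Y ^ (-τ - ε)) := by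
                gcongr
            _ = (Fintype.card ι * C ^ 2 * A) * (N ^ (s * ((1 + 3 * ε) / u)) *
                  (q * C⁻¹ * Y ^ (-τ - ε))) := by field_simp
            _ < (N : ℝ) ^ (1 - s * ((1 + 3 * ε) / u)) * (N ^ (s * ((1 + 3 * ε) / u)) *
                  (q * C⁻¹ * Y ^ (-τ - ε))) := by gcongr
            _ = N * (q * C⁻¹ * Y ^ (-τ - ε)) := by rw [← mul_assoc, e4]
            _ = _ := by ring
      _ ≤ q * |ℓ| := by gcongr
  have hint : ((∑ i, a i * x i : ℤ) : ℝ) = q * ℓ + ∑ i, a i * (x i - q * ξ i) := by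
    push_cast
    rw [Finset.mul_sum, ← Finset.sum_add_distrib]
    exact Finset.sum_congr rfl fun i _ => by ring
  have hqℓ : |q * ℓ| = q * |ℓ| := by rw [abs_mul, abs_of_pos hq0]
  set E := ∑ i, a i * (x i - q * ξ i)
  have hne : (∑ i, a i * x i : ℤ) ≠ 0 := by
    intro h0
    rw [h0, Int.cast_zero] at hint
    have : E = -(q * ℓ) := by linarith
    rw [this, abs_neg, hqℓ] at herr
    exact lt_irrefl _ herr
  have hge : (1 : ℝ) ≤ |((∑ i, a i * x i : ℤ) : ℝ)| := by
    rw [← Int.cast_abs]; exact_mod_cast Int.one_le_abs hne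
  have := abs_add_le (q * ℓ) E
  rw [hint] at hge
  linarith

/-! ### Slow growth and oscillation. -/

/-- If `Q (n + 1) = Q n ^ (1 + o(1))`, then every large scale is attained up to an exponent `1 + ε`
on a window of consecutive indices. -/
theorem exists_window_between_rpow (Q : ℕ → ℝ) (hQ_mono : Monotone Q)
    (hQ_lim : Tendsto Q atTop atTop) (ε : ℕ → ℝ) (hε : Tendsto ε atTop (𝓝 0))
    (hQ_succ : ∀ᶠ n in atTop, Q (n + 1) = Q n ^ (1 + ε n)) (T n₀ : ℕ) (e : ℝ) (he : 0 < e) :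
    ∃ Y₀ : ℝ, ∀ Y ≥ Y₀, ∃ n ≥ n₀, ∀ k < T, Y ≤ Q (n + k) ∧ Q (n + k) ≤ Y ^ (1 + e) := by
  have key : ∀ T : ℕ, ∀ e : ℝ, 0 < e → ∀ᶠ n in atTop, Q (n + T) ≤ Q n ^ (1 + e) := by
    intro T
    induction T with
    | zero =>
      intro e he
      filter_upwards [hQ_lim.eventually_ge_atTop 1] with n hn
      simpa using Real.self_le_rpow_of_one_le hn (by linarith : 1 ≤ 1 + e)
    | succ T ih =>
      intro e he
      obtain ⟨d, hd, hd1, hde⟩ : ∃ d > 0, d ≤ 1 ∧ 3 * d ≤ e :=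
        ⟨min 1 (e / 3), by positivity, min_le_left _ _, by linarith [min_le_right 1 (e / 3)]⟩
      have hs : ∀ᶠ n in atTop, Q (n + T + 1) = Q (n + T) ^ (1 + ε (n + T)) :=
        (tendsto_add_atTop_nat T).eventually hQ_succ
      have hεd : ∀ᶠ n in atTop, ε (n + T) < d :=
        (tendsto_add_atTop_nat T).eventually (hε.eventually_lt_const hd)
      filter_upwards [ih d hd, hs, hεd, hQ_lim.eventually_ge_atTop 1] with n h1 h2 h3 h4
      have h5 : 1 ≤ Q (n + T) := h4.trans (hQ_mono (by omega))
      rw [← add_assoc, h2]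
      calc Q (n + T) ^ (1 + ε (n + T)) ≤ Q (n + T) ^ (1 + d) :=
            Real.rpow_le_rpow_of_exponent_le h5 (by linarith)
        _ ≤ (Q n ^ (1 + d)) ^ (1 + d) := by gcongr
        _ = Q n ^ ((1 + d) * (1 + d)) := (Real.rpow_mul (by linarith) _ _).symm
        _ ≤ Q n ^ (1 + e) := Real.rpow_le_rpow_of_exponent_le h4 (by nlinarith)
  obtain ⟨n₁, hn₁⟩ := eventually_atTop.1
    ((key T e he).and ((hQ_lim.eventually_ge_atTop 1).and (eventually_ge_atTop n₀)))
  -- The `+ 1` forces the first `n` with `Y ≤ Q n` to exceed `n₁`, so the growth bound applies at `n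
  -- - 1`, where `Q < Y`.
  refine ⟨Q n₁ + 1, fun Y hY => ?_⟩
  classical
  have hex : ∃ n, Y ≤ Q n := (hQ_lim.eventually_ge_atTop Y).exists
  set n := Nat.find hex with hn
  have hYn : Y ≤ Q n := Nat.find_spec hex
  have hlt : n₁ < n := by
    by_contra! h
    have := hQ_mono h
    linarith
  have hpred : Q (n - 1) < Y := not_le.1 (Nat.find_min hex (by omega))
  obtain ⟨h1, h2, h3⟩ := hn₁ (n - 1) (by omega)
  refine ⟨n, by omega, fun k hk => ⟨hYn.trans (hQ_mono (by omega)), ?_⟩⟩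
  calc Q (n + k) ≤ Q (n - 1 + T) := hQ_mono (by omega)
    _ ≤ Q (n - 1) ^ (1 + e) := h1
    _ ≤ Y ^ (1 + e) := by gcongr

/-- A generalized power sum with roots on the unit circle is bounded below somewhere in each window
of consecutive indices. -/
theorem exists_le_norm_sum_mul_pow {T : ℕ} (hT : 1 ≤ T) (c ζ : Fin T → ℂ) (hc : ∀ t, c t ≠ 0)
    (hζ_inj : Function.Injective ζ) (hζ : ∀ t, ‖ζ t‖ = 1) :
    ∃ κ > 0, ∀ n : ℕ, ∃ k < T, κ ≤ ‖∑ t, c t * ζ t ^ (n + k)‖ := by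
  classical
  let t₀ : Fin T := ⟨0, hT⟩
  set V := Matrix.vandermonde ζ with hV
  have hdet : IsUnit V.det := (Matrix.det_vandermonde_ne_zero_iff.2 hζ_inj).isUnit
  set B := ∑ k, ‖V⁻¹ k t₀‖
  have hB : 0 ≤ B := by positivity
  have hc0 : 0 < ‖c t₀‖ := norm_pos_iff.2 (hc t₀)
  refine ⟨‖c t₀‖ / (B + 1), by positivity, fun n => ?_⟩
  by_contra! hlt
  -- The entries of `w` have modulus independent of `n`, and inverting one fixed Vandermonde matrix
  -- recovers them from the window.
  let w : Fin T → ℂ := fun t => c t * ζ t ^ n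
  have hS : Matrix.vecMul w V = fun k : Fin T => ∑ t, c t * ζ t ^ (n + k) := by
    ext k
    simp [Matrix.vecMul, dotProduct, hV, Matrix.vandermonde_apply, w, pow_add, mul_assoc]
  have hw : w t₀ = ∑ k : Fin T, (∑ t, c t * ζ t ^ (n + k)) * V⁻¹ k t₀ := by
    have : Matrix.vecMul (Matrix.vecMul w V) V⁻¹ = w := by
      rw [Matrix.vecMul_vecMul, Matrix.mul_nonsing_inv _ hdet, Matrix.vecMul_one]
    rw [hS] at this
    exact (congrFun this t₀).symm
  have hnorm : ‖w t₀‖ = ‖c t₀‖ := by simp [w, hζ]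
  have : ‖c t₀‖ ≤ ‖c t₀‖ / (B + 1) * B := by
    calc ‖c t₀‖ = ‖w t₀‖ := hnorm.symm
      _ ≤ ∑ k : Fin T, ‖(∑ t, c t * ζ t ^ (n + k)) * V⁻¹ k t₀‖ := by
        rw [hw]; exact norm_sum_le _ _
      _ ≤ ∑ k : Fin T, ‖c t₀‖ / (B + 1) * ‖V⁻¹ k t₀‖ := by
        gcongr with k
        rw [norm_mul]
        gcongr
        exact (hlt k k.2).le
      _ = _ := by rw [Finset.mul_sum]
  rw [div_mul_eq_mul_div, le_div_iff₀ (by positivity)] at this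
  nlinarith

/-! ### From the number field to integers and reals. -/

/-- The integral coordinates of an algebraic integer are bounded by its conjugates. -/
theorem exists_abs_repr_le_of_norm_embedding_le (K : Type*) [Field K] [NumberField K] :
    ∃ C > 0, ∀ (x : 𝓞 K) (B : ℝ), 0 ≤ B → (∀ σ : K →+* ℂ, ‖σ (x : K)‖ ≤ B) →
      ∀ i, |(((RingOfIntegers.basis K).repr x i : ℤ) : ℝ)| ≤ C * B := by
  let L : ((K →+* ℂ) → ℂ) →ₗ[ℂ] (Module.Free.ChooseBasisIndex ℤ (𝓞 K) → ℂ) :=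
    (canonicalEmbedding.latticeBasis K).equivFun.toLinearMap
  let L' := LinearMap.toContinuousLinearMap L
  refine ⟨‖L'‖ + 1, by positivity, fun x B hB hx i => ?_⟩
  have h1 : L' (canonicalEmbedding K x) i = (((RingOfIntegers.basis K).repr x i : ℤ) : ℂ) := by
    have := canonicalEmbedding.integralBasis_repr_apply K (x : K) i
    rw [NumberField.integralBasis_repr_apply K x i] at this
    simp [L', L, this]
  have h2 : ‖canonicalEmbedding K (x : K)‖ ≤ B := (pi_norm_le_iff_of_nonneg hB).2 hx
  calc |(((RingOfIntegers.basis K).repr x i : ℤ) : ℝ)|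
      = ‖L' (canonicalEmbedding K x) i‖ := by rw [h1]; simp
    _ ≤ ‖L' (canonicalEmbedding K x)‖ := norm_le_pi_norm _ i
    _ ≤ ‖L'‖ * B := L'.le_opNorm_of_le h2
    _ ≤ (‖L'‖ + 1) * B := by nlinarith

/-- A family in a finite-dimensional span is an integral combination of `finrank` vectors. -/
theorem exists_eq_sum_ringOfIntegers_mul {K : Type*} [Field K] [NumberField K] [Algebra K ℂ]
    {N : ℕ} (θ : Fin N → ℂ) :
    ∃ (f : Fin (Module.finrank K (Submodule.span K (Set.range θ))) → ℂ)
      (r : Fin N → Fin (Module.finrank K (Submodule.span K (Set.range θ))) → 𝓞 K),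
      ∀ j, θ j = ∑ k, algebraMap K ℂ (r j k : K) * f k := by
  classical
  set V := Submodule.span K (Set.range θ)
  have : FiniteDimensional K V := FiniteDimensional.span_of_finite K (Set.finite_range θ)
  let b := Module.finBasis K V
  have hmem (j) : θ j ∈ V := Submodule.subset_span ⟨j, rfl⟩
  obtain ⟨M, hM⟩ := IsLocalization.exist_integer_multiples_of_finite (nonZeroDivisors (𝓞 K))
    (fun jk : Fin N × Fin (Module.finrank K V) => b.repr ⟨θ jk.1, hmem jk.1⟩ jk.2)
  choose r hr using fun j k => hM (j, k)
  have hM0 : algebraMap K ℂ ((M : 𝓞 K) : K) ≠ 0 := by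
    simp
  -- The common denominator `M` is absorbed into the vectors.
  refine ⟨fun k => (algebraMap K ℂ ((M : 𝓞 K) : K))⁻¹ * (b k : ℂ), r, fun j => ?_⟩
  have h1 : θ j = ∑ k, algebraMap K ℂ (b.repr ⟨θ j, hmem j⟩ k) * (b k : ℂ) := by
    have := congrArg V.subtype (b.sum_repr ⟨θ j, hmem j⟩)
    rw [map_sum] at this
    simp only [map_smul, Submodule.subtype_apply, Algebra.smul_def] at this
    exact this.symm
  conv_lhs => rw [h1]
  refine Finset.sum_congr rfl fun k _ => ?_
  have h2 : ((r j k : 𝓞 K) : K) = (M : 𝓞 K) * b.repr ⟨θ j, hmem j⟩ k := by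
    exact (hr j k).trans (Algebra.smul_def _ _)
  rw [h2, map_mul]
  field_simp

/-- After multiplication by `1` or by a fixed algebraic integer, the real part of a `K`-linear form
in elements of `realOrComplexField K` is comparable to its modulus. -/
theorem exists_norm_le_abs_re_or {K : Type*} [Field K] [NumberField K] [Algebra K ℂ] :
    ∃ (α : 𝓞 K) (C : ℝ), 0 < C ∧ ∀ {N : ℕ} (θ : Fin N → ℂ), (∀ j, θ j ∈ realOrComplexField K) →
      ∀ p : Fin N → K, ∀ z, z = ∑ j, algebraMap K ℂ (p j) * θ j →
        ‖z‖ ≤ C * |z.re| ∨ ‖z‖ ≤ C * |(algebraMap K ℂ (α : K) * z).re| := by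
  by_cases hK : (algebraMap K ℂ).fieldRange ≤ Complex.ofRealHom.fieldRange
  · refine ⟨1, 1, one_pos, fun θ hθ p z hz => Or.inl ?_⟩
    rw [realOrComplexField, if_pos hK] at hθ
    have hz' : z ∈ Complex.ofRealHom.fieldRange := by
      rw [hz]
      exact sum_mem fun j _ => mul_mem (hK ⟨_, rfl⟩) (hθ j)
    obtain ⟨x, rfl⟩ := hz'
    simp
  · obtain ⟨α, hα⟩ : ∃ α : 𝓞 K, (algebraMap K ℂ (α : K)).im ≠ 0 := by
      by_contra! h0
      refine hK ?_
      rintro _ ⟨y, rfl⟩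
      have hreal (a : 𝓞 K) : algebraMap K ℂ (a : K) ∈ Complex.ofRealHom.fieldRange :=
        ⟨(algebraMap K ℂ (a : K)).re, Complex.ext (by simp) (by simp [h0 a])⟩
      obtain ⟨a, b, -, rfl⟩ := IsFractionRing.div_surjective (A := 𝓞 K) y
      rw [map_div₀]
      exact div_mem (hreal a) (hreal b)
    set w := algebraMap K ℂ (α : K)
    have hw : 0 < |w.im| := abs_pos.2 hα
    refine ⟨α, 2 * max (1 + |w.re| / |w.im|) (1 / |w.im|), by positivity,
      fun θ hθ p z hz => ?_⟩
    clear hz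
    -- As `w` is not real, `Re z` and `Re (w * z)` determine `z`.
    have h1 : |z.im| ≤ |w.re| / |w.im| * |z.re| + 1 / |w.im| * |(w * z).re| := by
      have : |w.im| * |z.im| ≤ |w.re| * |z.re| + |(w * z).re| := by
        rw [← abs_mul, ← abs_mul]
        have : w.im * z.im = w.re * z.re - (w * z).re := by rw [Complex.mul_re]; ring
        rw [this]
        exact abs_sub _ _
      calc |z.im| = (|w.im| * |z.im|) / |w.im| := by field_simp
        _ ≤ (|w.re| * |z.re| + |(w * z).re|) / |w.im| := by gcongr
        _ = _ := by ring
    have h2 := Complex.norm_le_abs_re_add_abs_im z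
    set m := max (1 + |w.re| / |w.im|) (1 / |w.im|)
    have h3 : ‖z‖ ≤ m * |z.re| + m * |(w * z).re| := by
      calc ‖z‖ ≤ (1 + |w.re| / |w.im|) * |z.re| + 1 / |w.im| * |(w * z).re| := by linarith
        _ ≤ _ := by
          gcongr
          exacts [le_max_left _ _, le_max_right _ _]
    rcases le_total (m * |z.re|) (m * |(w * z).re|) with h | h
    · right; linarith
    · left; linarith

/-! ### Small forms at every scale, and the dimension bound. -/

/-- Oscillating linear forms yield, at every large scale `Y`, a form of modulus `Y ^ (-τ + o(1))`
whose coefficients have conjugates bounded by `Y ^ (1 + o(1))`. -/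
theorem exists_small_forms_of_oscillating {K : Type*} [Field K] [NumberField K] [Algebra K ℂ]
    (Q : ℕ → ℝ) (hQ_mono : Monotone Q) (hQ_lim : Tendsto Q atTop atTop)
    (ε : ℕ → ℝ) (hε : Tendsto ε atTop (𝓝 0))
    (hQ_succ : ∀ᶠ n in atTop, Q (n + 1) = Q n ^ (1 + ε n))
    (T : ℕ) (hT : 1 ≤ T) (c ζ : Fin T → ℂ) (hc : ∀ t, c t ≠ 0)
    (hζ_inj : Function.Injective ζ) (hζ : ∀ t, ‖ζ t‖ = 1)
    (N : ℕ) (θ : Fin N → ℂ) (τ : ℝ) (hτ : 0 < τ)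
    (p : Fin N → ℕ → 𝓞 K)
    (δ : Fin N → ℕ → ℝ) (hδ : ∀ j, Tendsto (δ j) atTop (𝓝 0))
    (hp : ∀ j, ∀ᶠ n in atTop, ∀ σ : K →+* ℂ, ‖σ (p j n : K)‖ < Q n ^ (1 + δ j n))
    (η ρ : ℕ → ℂ) (hη : Tendsto η atTop (𝓝 0)) (hρ : Tendsto ρ atTop (𝓝 0))
    (hform : ∀ᶠ n in atTop,
      ∑ j, algebraMap K ℂ (p j n : K) * θ j =
        (Q n : ℂ) ^ (-(τ : ℂ) + η n) * (∑ t, c t * ζ t ^ n + ρ n)) :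
    ∃ C > 0, ∀ e > 0, ∃ Y₀ : ℝ, ∀ Y ≥ Y₀, ∃ n,
      (∀ j, ∀ σ : K →+* ℂ, ‖σ (p j n : K)‖ ≤ Y ^ (1 + e)) ∧
      C⁻¹ * Y ^ (-τ - e) ≤ ‖∑ j, algebraMap K ℂ (p j n : K) * θ j‖ ∧
      ‖∑ j, algebraMap K ℂ (p j n : K) * θ j‖ ≤ C * Y ^ (-τ + e) := by
  obtain ⟨κ, hκ, hwin⟩ := exists_le_norm_sum_mul_pow hT c ζ hc hζ_inj hζ
  have hS (n : ℕ) : ‖∑ t, c t * ζ t ^ n‖ ≤ ∑ t, ‖c t‖ :=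
    (norm_sum_le _ _).trans_eq (by simp [hζ])
  have hC0 : 0 ≤ ∑ t, ‖c t‖ := by positivity
  refine ⟨(∑ t, ‖c t‖) + κ + 2 / κ, by positivity, fun e he => ?_⟩
  set C := (∑ t, ‖c t‖) + κ + 2 / κ with hC
  have hCκ : C⁻¹ ≤ κ / 2 := by
    rw [← inv_div]
    refine inv_anti₀ (by positivity) ?_
    rw [hC]; linarith
  have hCpos : 0 < C := by positivity
  -- `d ≤ τ` keeps `-τ + d` nonpositive, so that `Y ≤ Q n` bounds the form from above; the last
  -- condition absorbs `(1 + d) * (1 + d)` and `(1 + d) * (τ + d)`.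
  obtain ⟨d, hd, hd1, hdτ, hde⟩ : ∃ d > 0, d ≤ 1 ∧ d ≤ τ ∧ d * (τ + 3) ≤ e := by
    refine ⟨min 1 (min τ (e / (τ + 3))), by positivity, min_le_left _ _,
      (min_le_right _ _).trans (min_le_left _ _), ?_⟩
    rw [← le_div_iff₀ (by positivity)]
    exact (min_le_right _ _).trans (min_le_right _ _)
  have hdτ0 : 0 < d * τ := by positivity
  have hdd : d * d ≤ d := by nlinarith
  have hδ' : ∀ᶠ n in atTop, ∀ j, δ j n < d :=
    eventually_all.2 fun j => (hδ j).eventually_lt_const hd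
  have hη' : ∀ᶠ n in atTop, ‖η n‖ < d := hη.norm.eventually_lt_const (by simpa using hd)
  have hρ' : ∀ᶠ n in atTop, ‖ρ n‖ < κ / 2 :=
    hρ.norm.eventually_lt_const (by rw [norm_zero]; positivity)
  obtain ⟨n₀, hn₀⟩ := eventually_atTop.1
    ((eventually_all.2 hp).and (hδ'.and (hη'.and (hρ'.and hform))))
  obtain ⟨Y₀, hY₀⟩ := exists_window_between_rpow Q hQ_mono hQ_lim ε hε hQ_succ T n₀ d hd
  refine ⟨max Y₀ 1, fun Y hY => ?_⟩
  obtain ⟨m, hm, hmk⟩ := hY₀ Y ((le_max_left _ _).trans hY)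
  have hY1 : 1 ≤ Y := (le_max_right _ _).trans hY
  have hY0 : 0 < Y := by linarith
  obtain ⟨k, hkT, hk⟩ := hwin m
  obtain ⟨hQ1, hQ2⟩ := hmk k hkT
  obtain ⟨h1, h2, h3, h4, h5⟩ := hn₀ (m + k) (by omega)
  set n := m + k
  have hQ1' : 1 ≤ Q n := hY1.trans hQ1
  have hQ0 : 0 < Q n := by linarith
  have hre := abs_le.1 ((Complex.abs_re_le_norm (η n)).trans h3.le)
  have hnorm : ‖∑ j, algebraMap K ℂ (p j n : K) * θ j‖ =
      Q n ^ (-τ + (η n).re) * ‖∑ t, c t * ζ t ^ n + ρ n‖ := by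
    rw [h5, norm_mul, Complex.norm_cpow_eq_rpow_re_of_pos hQ0]
    simp
  have hlow : κ / 2 ≤ ‖∑ t, c t * ζ t ^ n + ρ n‖ := by
    have := norm_sub_le_norm_add (∑ t, c t * ζ t ^ n) (ρ n)
    linarith
  have hupp : ‖∑ t, c t * ζ t ^ n + ρ n‖ ≤ C := by
    have h6 := norm_add_le (∑ t, c t * ζ t ^ n) (ρ n)
    have h7 := hS n
    have : 0 < 2 / κ := by positivity
    rw [hC]; linarith
  refine ⟨n, fun j σ => ?_, ?_, ?_⟩
  · calc ‖σ (p j n : K)‖ ≤ Q n ^ (1 + δ j n) := (h1 j σ).le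
      _ ≤ Q n ^ (1 + d) := Real.rpow_le_rpow_of_exponent_le hQ1' (by linarith [h2 j])
      _ ≤ (Y ^ (1 + d)) ^ (1 + d) := by gcongr
      _ = Y ^ ((1 + d) * (1 + d)) := (Real.rpow_mul hY0.le _ _).symm
      _ ≤ Y ^ (1 + e) := Real.rpow_le_rpow_of_exponent_le hY1 (by nlinarith)
  · have : Y ^ (-τ - e) ≤ Q n ^ (-τ + (η n).re) := by
      calc Y ^ (-τ - e) ≤ Y ^ ((1 + d) * (-(τ + d))) :=
            Real.rpow_le_rpow_of_exponent_le hY1 (by nlinarith)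
        _ = (Y ^ (1 + d)) ^ (-(τ + d)) := Real.rpow_mul hY0.le _ _
        _ ≤ Q n ^ (-(τ + d)) := Real.rpow_le_rpow_of_nonpos hQ0 hQ2 (by linarith)
        _ ≤ Q n ^ (-τ + (η n).re) := Real.rpow_le_rpow_of_exponent_le hQ1' (by linarith [hre.1])
    rw [hnorm, mul_comm]
    gcongr
    exact hCκ.trans hlow
  · have : Q n ^ (-τ + (η n).re) ≤ Y ^ (-τ + e) := by
      calc Q n ^ (-τ + (η n).re) ≤ Q n ^ (-τ + d) :=
            Real.rpow_le_rpow_of_exponent_le hQ1' (by linarith [hre.2])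
        _ ≤ Y ^ (-τ + d) := Real.rpow_le_rpow_of_nonpos hY0 hQ1 (by linarith)
        _ ≤ Y ^ (-τ + e) := Real.rpow_le_rpow_of_exponent_le hY1 (by nlinarith)
    rw [hnorm, mul_comm]
    gcongr

/-- Small `K`-linear forms at every scale force the `K`-span of the point to be large. -/
theorem add_one_le_finrank_mul_of_small_forms {K : Type*} [Field K] [NumberField K] [Algebra K ℂ]
    {N : ℕ} (θ : Fin N → ℂ) (hθ : ∀ j, θ j ∈ realOrComplexField K) (τ : ℝ) (hτ : 0 < τ)
    (C : ℝ) (hC : 0 < C)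
    (h : ∀ e > 0, ∃ Y₀ : ℝ, ∀ Y ≥ Y₀, ∃ p : Fin N → 𝓞 K,
      (∀ j, ∀ σ : K →+* ℂ, ‖σ (p j : K)‖ ≤ Y ^ (1 + e)) ∧
      C⁻¹ * Y ^ (-τ - e) ≤ ‖∑ j, algebraMap K ℂ (p j : K) * θ j‖ ∧
      ‖∑ j, algebraMap K ℂ (p j : K) * θ j‖ ≤ C * Y ^ (-τ + e)) :
    τ + 1 ≤ Module.finrank K (Submodule.span K (Set.range θ)) * Module.finrank ℚ K := by
  obtain ⟨α, C₁, hC₁, hα⟩ := exists_norm_le_abs_re_or (K := K)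
  obtain ⟨C₂, hC₂, hcoord⟩ := exists_abs_repr_le_of_norm_embedding_le K
  have hbasis := exists_eq_sum_ringOfIntegers_mul (K := K) θ
  generalize Module.finrank K (Submodule.span K (Set.range θ)) = d at hbasis ⊢
  obtain ⟨f, r, hfr⟩ := hbasis
  let ω := RingOfIntegers.basis K
  have hcard : Fintype.card (Fin d × Module.Free.ChooseBasisIndex ℤ (𝓞 K)) =
      d * Module.finrank ℚ K := by
    rw [Fintype.card_prod, Fintype.card_fin, ← Module.finrank_eq_card_chooseBasisIndex,
      RingOfIntegers.rank]
  let ξ : Fin d × Module.Free.ChooseBasisIndex ℤ (𝓞 K) → ℝ :=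
    fun ki => (algebraMap K ℂ (ω ki.2 : K) * f ki.1).re
  let R : ℝ := ∑ σ : K →+* ℂ, ∑ k, ∑ j, (1 + ‖σ (α : K)‖) * ‖σ (r j k : K)‖
  have hR : 0 ≤ R := by positivity
  have hmain := add_one_le_card_of_small_forms ξ τ hτ
    (C₂ * R + (1 + ‖algebraMap K ℂ (α : K)‖) * C + C₁ * C) (by positivity) ?_
  · rw [hcard] at hmain
    exact_mod_cast hmain
  intro e he
  obtain ⟨Y₀, hY₀⟩ := h e he
  refine ⟨max Y₀ 1, fun Y hY => ?_⟩
  obtain ⟨p, hp1, hp2, hp3⟩ := hY₀ Y ((le_max_left _ _).trans hY)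
  have hY0 : 0 < Y := lt_of_lt_of_le one_pos ((le_max_right _ _).trans hY)
  set z := ∑ j, algebraMap K ℂ (p j : K) * θ j with hz
  -- `β` may vary with `Y`, but takes only the values `1` and `α`, so the constants stay uniform.
  obtain ⟨β, hβ1, hβ2⟩ : ∃ β : 𝓞 K, (∀ σ : K →+* ℂ, ‖σ (β : K)‖ ≤ 1 + ‖σ (α : K)‖) ∧
      ‖z‖ ≤ C₁ * |(algebraMap K ℂ (β : K) * z).re| := by
    rcases hα θ hθ (fun j => (p j : K)) z hz with h | h
    · exact ⟨1, fun σ => by simp, by simpa using h⟩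
    · exact ⟨α, fun σ => by simp, h⟩
  let P : Fin d → 𝓞 K := fun k => ∑ j, β * p j * r j k
  have hP (k) (σ : K →+* ℂ) : ‖σ (P k : K)‖ ≤ R * Y ^ (1 + e) := by
    calc ‖σ (P k : K)‖ = ‖∑ j, σ (β : K) * σ (p j : K) * σ (r j k : K)‖ := by
          simp only [P, map_sum, map_mul]
      _ ≤ ∑ j, ‖σ (β : K) * σ (p j : K) * σ (r j k : K)‖ := norm_sum_le _ _
      _ ≤ ∑ j, (1 + ‖σ (α : K)‖) * Y ^ (1 + e) * ‖σ (r j k : K)‖ := by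
          gcongr with j
          rw [norm_mul, norm_mul]
          gcongr
          exacts [hβ1 σ, hp1 j σ]
      _ = (∑ j, (1 + ‖σ (α : K)‖) * ‖σ (r j k : K)‖) * Y ^ (1 + e) := by
          rw [Finset.sum_mul]; exact Finset.sum_congr rfl fun j _ => by ring
      _ ≤ R * Y ^ (1 + e) := by
          gcongr
          calc _ ≤ ∑ k, ∑ j, (1 + ‖σ (α : K)‖) * ‖σ (r j k : K)‖ :=
                Finset.single_le_sum (f := fun k => ∑ j, (1 + ‖σ (α : K)‖) * ‖σ (r j k : K)‖)
                  (fun _ _ => by positivity) (Finset.mem_univ k)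
            _ ≤ R := Finset.single_le_sum
                  (f := fun σ : K →+* ℂ => ∑ k, ∑ j, (1 + ‖σ (α : K)‖) * ‖σ (r j k : K)‖)
                  (fun _ _ => by positivity) (Finset.mem_univ σ)
  have hsum : ∑ ki, (ω.repr (P ki.1) ki.2 : ℝ) * ξ ki = (algebraMap K ℂ (β : K) * z).re := by
    have h1 (k) : algebraMap K ℂ (P k : K) =
        ∑ i, (ω.repr (P k) i : ℂ) * algebraMap K ℂ (ω i : K) := by
      conv_lhs => rw [← ω.sum_repr (P k)]
      simp [map_sum]
    have h2 : algebraMap K ℂ (β : K) * z = ∑ k, algebraMap K ℂ (P k : K) * f k := by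
      rw [hz, Finset.mul_sum]
      simp_rw [hfr, P, map_sum, map_mul, Finset.mul_sum, Finset.sum_mul]
      rw [Finset.sum_comm]
      exact Finset.sum_congr rfl fun k _ => Finset.sum_congr rfl fun j _ => by ring
    rw [h2, Fintype.sum_prod_type, Complex.re_sum]
    refine Finset.sum_congr rfl fun k _ => ?_
    rw [h1, Finset.sum_mul, Complex.re_sum]
    refine Finset.sum_congr rfl fun i _ => ?_
    rw [mul_assoc, ← Complex.ofReal_intCast, Complex.re_ofReal_mul]
  refine ⟨fun ki => ω.repr (P ki.1) ki.2, fun ki => ?_, ?_, ?_⟩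
  · calc _ ≤ C₂ * (R * Y ^ (1 + e)) := hcoord (P ki.1) _ (by positivity) (hP ki.1) ki.2
      _ = C₂ * R * Y ^ (1 + e) := by ring
      _ ≤ _ := by
        gcongr
        have : 0 ≤ (1 + ‖algebraMap K ℂ (α : K)‖) * C := by positivity
        have : 0 < C₁ * C := by positivity
        linarith
  · rw [hsum]
    have hinv : (C₂ * R + (1 + ‖algebraMap K ℂ (α : K)‖) * C + C₁ * C)⁻¹ ≤ C₁⁻¹ * C⁻¹ := by
      rw [← mul_inv]
      refine inv_anti₀ (by positivity) ?_
      have : 0 ≤ (1 + ‖algebraMap K ℂ (α : K)‖) * C := by positivity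
      have : 0 ≤ C₂ * R := by positivity
      linarith
    calc _ ≤ C₁⁻¹ * C⁻¹ * Y ^ (-τ - e) := by gcongr
      _ = C₁⁻¹ * (C⁻¹ * Y ^ (-τ - e)) := by ring
      _ ≤ C₁⁻¹ * (C₁ * |(algebraMap K ℂ (β : K) * z).re|) :=
        mul_le_mul_of_nonneg_left (hp2.trans hβ2) (by positivity)
      _ = _ := inv_mul_cancel_left₀ hC₁.ne' _
  · rw [hsum]
    calc |(algebraMap K ℂ (β : K) * z).re| ≤ ‖algebraMap K ℂ (β : K) * z‖ :=
          Complex.abs_re_le_norm _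
      _ ≤ (1 + ‖algebraMap K ℂ (α : K)‖) * (C * Y ^ (-τ + e)) := by
        rw [norm_mul]
        gcongr
        exact hβ1 (algebraMap K ℂ)
      _ = (1 + ‖algebraMap K ℂ (α : K)‖) * C * Y ^ (-τ + e) := by ring
      _ ≤ _ := by
        gcongr
        have : 0 ≤ C₂ * R := by positivity
        have : 0 < C₁ * C := by positivity
        linarith

theorem mainTheorem3
    {K : Type*} [Field K] [NumberField K] [Algebra K ℂ]
    (Q : ℕ → ℝ) (hQ_pos : ∀ n, 0 < Q n) (hQ_mono : Monotone Q) (hQ_lim : Tendsto Q atTop atTop)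
    (ε : ℕ → ℝ) (hε : Tendsto ε atTop (𝓝 0))
    (hQ_succ : ∀ᶠ n in atTop, Q (n + 1) = Q n ^ (1 + ε n))
    (T : ℕ) (hT : 1 ≤ T) (c ζ : Fin T → ℂ) (hc : ∀ t, c t ≠ 0)
    (hζ_inj : Function.Injective ζ) (hζ : ∀ t, ‖ζ t‖ = 1)
    (N : ℕ) (θ : Fin N → ℂ) (hθ : ∀ j, θ j ∈ realOrComplexField K)
    (τ : ℝ) (hτ : 0 < τ)
    (p : Fin N → ℕ → 𝓞 K)
    (δ : Fin N → ℕ → ℝ) (hδ : ∀ j, Tendsto (δ j) atTop (𝓝 0))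
    (hp : ∀ j, ∀ᶠ n in atTop, ∀ σ : K →+* ℂ, ‖σ (p j n : K)‖ < Q n ^ (1 + δ j n))
    (η ρ : ℕ → ℂ) (hη : Tendsto η atTop (𝓝 0)) (hρ : Tendsto ρ atTop (𝓝 0))
    (hform : ∀ᶠ n in atTop,
      ∑ j, algebraMap K ℂ (p j n : K) * θ j =
        (Q n : ℂ) ^ (-(τ : ℂ) + η n) * (∑ t, c t * ζ t ^ n + ρ n)) :
    (τ + 1) / (Module.finrank ℚ K : ℝ) ≤
      (Module.finrank K (Submodule.span K (Set.range θ)) : ℝ) := by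
  obtain ⟨C, hC, h⟩ := exists_small_forms_of_oscillating Q hQ_mono hQ_lim ε hε hQ_succ T hT c ζ hc
    hζ_inj hζ N θ τ hτ p δ hδ hp η ρ hη hρ hform
  have hpos : (0 : ℝ) < Module.finrank ℚ K := by exact_mod_cast Module.finrank_pos
  rw [div_le_iff₀ hpos]
  refine add_one_le_finrank_mul_of_small_forms θ hθ τ hτ C hC fun e he => ?_
  obtain ⟨Y₀, hY₀⟩ := h e he
  exact ⟨Y₀, fun Y hY => let ⟨n, hn⟩ := hY₀ Y hY; ⟨fun j => p j n, hn⟩⟩
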